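/- Write $|\cdot|$ for the Euclidean norm on $\mathbb R^N$ and $B_r(z)$ for Euclidean balls. A convex function $g:\mathbb R^N\to[0,\infty)$ is called cylinder-like if for all $\bar x\ne\bar y$ in $\mathbb R^N$ with $g(\bar x)=g(\bar y)$ there are $\epsilon,\delta>0$ such that $g(x-\epsilon(\bar x-\bar y))\le g(x)$ for all $x\in B_\delta(\bar x)$ and $g(y+\epsilon(\bar x-\bar y))\le g(y)$ for all $y\in B_\delta(\bar y)$. Let $\|\cdot\|$ be a cylinder-like norm on $\mathbb R^N$, let $1<p<\infty$, and put $c(x,y)=\|y-x\|^p$. Let $\mu,\nu$ be Borel probability measures on $\mathbb R^N$ with finite $p$-th moments and $\mu\ll\mathscr L^N$. Let $\mathsf{Adm}(\mu,\nu)$ be the set of Borel probability measures on $\mathbb R^N\times\mathbb R^N$ with marginals $\mu$ and $\nu$, let $\mathscr C(\mu,\nu)=\inf_{\pi\in\mathsf{Adm}(\mu,\nu)}\int c\,d\pi$, let $\Pi_1(\mu,\nu)$ be the set of minimisers of $\int c\,d\pi$ over $\mathsf{Adm}(\mu,\nu)$, and let $\Pi_2(\mu,\nu)$ be the set of minimisers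 of $\int|x-y|^2\,d\pi$ over $\Pi_1(\mu,\nu)$ (integrals with values in $[0,\infty]$). A plan $\pi$ is induced by a map if $\pi=(\mathrm{id},T)_\#\mu$ for some $\mu$-measurable $T:\mathbb R^N\to\mathbb R^N$. Then: 1. $\mathscr C(\mu,\nu)<\infty$. 2. $\Pi_2(\mu,\nu)$ contains an element that is induced by a map; in particular an optimal transport map exists. 3. If $p\ge 2$, or if $1<p<2$ and $\inf_{\pi\in\Pi_1(\mu,\nu)}\int|x-y|^2\,d\pi<\infty$ (for instance if $\mu$ and $\nu$ have finite second moments), then $\Pi_2(\mu,\nu)$ has exactly one element, and it is induced by a map. Moreover, every norm on $\mathbb R^2$ is cylinder-like, and for every finite set $V\subset\mathbb R^N$ spanning $\mathbb R^N$ the crystalline norm $x\mapsto\max_{v\in V}|\langle x,v\rangle|$ is a norm and is cylinder-like. -/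

import Mathlib

open MeasureTheory
open scoped ENNReal

noncomputable section

namespace CylTransport

/-- `ℝ^N` with its Euclidean norm (so `‖·‖`, `edist`, `Metric.ball` are the Euclidean ones). -/
abbrev E (N : ℕ) : Type := EuclideanSpace ℝ (Fin N)

/-- A seminorm on `ℝ^N` that is a norm. -/
def IsNorm {N : ℕ} (n : Seminorm ℝ (E N)) : Prop :=
  ∀ x, n x = 0 → x = 0

/-- Cylinder-like convex functions `ℝ^N → [0, ∞)`. -/
def CylinderLike {N : ℕ} (g : E N → ℝ) : Prop :=
  (∀ x, 0 ≤ g x) ∧ ConvexOn ℝ Set.univ g ∧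
    ∀ x₀ y₀ : E N, x₀ ≠ y₀ → g x₀ = g y₀ →
      ∃ ε : ℝ, 0 < ε ∧ ∃ δ : ℝ, 0 < δ ∧
        (∀ x ∈ Metric.ball x₀ δ, g (x - ε • (x₀ - y₀)) ≤ g x) ∧
        (∀ y ∈ Metric.ball y₀ δ, g (y + ε • (x₀ - y₀)) ≤ g y)

/-- The crystalline norm `x ↦ max_{v ∈ V} |⟨v, x⟩|` of a finite set `V` of vectors. -/
def crystalline {N : ℕ} (V : Finset (E N)) : Seminorm ℝ (E N) :=
  V.sup fun v => (normSeminorm ℝ ℝ).comp (innerₗ (E N) v)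

theorem crystalline_apply {N : ℕ} (V : Finset (E N)) (hV : V.Nonempty) (x : E N) :
    crystalline V x = V.sup' hV fun v => |inner ℝ x v| := by
  apply le_antisymm
  · refine Seminorm.finset_sup_apply_le ?_ fun v hv => ?_
    · obtain ⟨v, hv⟩ := hV
      exact (abs_nonneg (inner ℝ x v)).trans
        (Finset.le_sup' (fun v => |inner ℝ x v|) hv)
    · have : ((normSeminorm ℝ ℝ).comp (innerₗ (E N) v)) x = |inner ℝ x v| := by
        simp [Seminorm.comp_apply, real_inner_comm]
      rw [this]
      exact Finset.le_sup' (fun v => |inner ℝ x v|) hv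
  · refine Finset.sup'_le _ _ fun v hv => ?_
    have h : ((normSeminorm ℝ ℝ).comp (innerₗ (E N) v)) ≤ crystalline V :=
      Finset.le_sup (f := fun v => (normSeminorm ℝ ℝ).comp (innerₗ (E N) v)) hv
    have := h x
    simpa [Seminorm.comp_apply, real_inner_comm] using this

/-- Admissible transport plans: couplings of `μ` and `ν`. -/
def Adm {N : ℕ} (μ ν : Measure (E N)) : Set (Measure (E N × E N)) :=
  {π | IsProbabilityMeasure π ∧ π.map Prod.fst = μ ∧ π.map Prod.snd = ν}

/-- The total cost `∫ c dπ` of a plan. -/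
def planCost {N : ℕ} (c : E N → E N → ℝ≥0∞) (π : Measure (E N × E N)) : ℝ≥0∞ :=
  ∫⁻ z, c z.1 z.2 ∂π

/-- The optimal transport cost from `μ` to `ν`. -/
def transportCost {N : ℕ} (c : E N → E N → ℝ≥0∞) (μ ν : Measure (E N)) : ℝ≥0∞ :=
  ⨅ π ∈ Adm μ ν, planCost c π

/-- Optimal plans: minimisers of the Kantorovich problem. -/
def Plans₁ {N : ℕ} (c : E N → E N → ℝ≥0∞) (μ ν : Measure (E N)) :
    Set (Measure (E N × E N)) :=
  {π | π ∈ Adm μ ν ∧ ∀ π' ∈ Adm μ ν, planCost c π ≤ planCost c π'}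

/-- The squared Euclidean distance. -/
def sqDist {N : ℕ} (x y : E N) : ℝ≥0∞ := edist x y ^ 2

/-- The value of the secondary variational problem. -/
def secondaryCost {N : ℕ} (c : E N → E N → ℝ≥0∞) (μ ν : Measure (E N)) : ℝ≥0∞ :=
  ⨅ π ∈ Plans₁ c μ ν, planCost sqDist π

/-- Minimisers of the secondary variational problem. -/
def Plans₂ {N : ℕ} (c : E N → E N → ℝ≥0∞) (μ ν : Measure (E N)) :
    Set (Measure (E N × E N)) :=
  {π | π ∈ Plans₁ c μ ν ∧ ∀ π' ∈ Plans₁ c μ ν, planCost sqDist π ≤ planCost sqDist π'}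

/-- The plan `π` is `(id, T)_# μ` for some `μ`-measurable map `T`. -/
def InducedByMap {N : ℕ} (μ : Measure (E N)) (π : Measure (E N × E N)) : Prop :=
  ∃ T : E N → E N, AEMeasurable T μ ∧ π = μ.map (fun x => (x, T x))

/-- The cost `c(x, y) = n(y - x)^p`. -/
def normCost {N : ℕ} (n : Seminorm ℝ (E N)) (p : ℝ) (x y : E N) : ℝ≥0∞ :=
  ENNReal.ofReal (n (y - x) ^ p)

/-- Finite moment of order `p`. -/
def FiniteMoment {N : ℕ} (p : ℝ) (μ : Measure (E N)) : Prop :=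
  ∫⁻ x, ENNReal.ofReal (‖x‖ ^ p) ∂μ < ∞

end CylTransport

end

/-!
Disintegrate a secondary minimiser `π` over `μ` and suppose that on a set of positive `μ`-measure
the conditional laws of the displacement `y - x` charge neighbourhoods of two distinct points `a`
and `b`. Since `μ` is absolutely continuous, this set meets its translates by small multiples `v` of
`a - b` in positive measure, so `π` transports mass from `x` with displacement near `a` and mass
from `x + v` with displacement near `b`. Exchanging the two targets preserves the marginals, moves
the displacements towards each other, and lowers the pair (primary cost, secondary cost)
lexicographically: if the norms of `a` and `b` differ, the primary cost drops by strict convexity of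
`t ↦ t ^ p`; if they agree, the primary cost does not increase because the norm is cylinder-like,
while the secondary cost drops by strict convexity. Hence almost every conditional law is a Dirac
mass. Two secondary minimisers coincide because their average is again one, and is therefore carried
by a single graph.

For a seminorm on the plane and points `a ≠ b` of common value `m`, either the midpoint has a
smaller value, and the cylinder condition holds by continuity, or the segment `[a, b]` lies in the
sphere of radius `m`. In the latter case, unless `m = 0`, the points form a basis, the linear form
equal to `m` at both of them agrees with the seminorm on the cone they span and is at most the
seminorm nearby, and half of the displacement from one point to the other leads into that cone.
-/

namespace CylTransport

open Set Filter ProbabilityTheory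
open scoped Topology

section Convexity

variable {F : Type*} [AddCommGroup F] [Module ℝ F] {f : F → ℝ}

theorem convexOn_sub_smul_sub_le (hf : ConvexOn ℝ univ f) {ε t : ℝ} (hε : 0 < ε) (ht : 0 ≤ t)
    (htε : t ≤ ε) (x d : F) : f (x - t • d) - f x ≤ t / ε * (f (x - ε • d) - f x) := by
  have hcomb : (1 - t / ε) • x + (t / ε) • (x - ε • d) = x - t • d := by
    rw [smul_sub, smul_smul, div_mul_cancel₀ _ hε.ne', sub_smul, one_smul]
    abel
  have hconv := hf.2 (mem_univ x) (mem_univ (x - ε • d))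
    (sub_nonneg.2 ((div_le_one hε).2 htε)) (div_nonneg ht hε.le) (by ring)
  rw [hcomb, smul_eq_mul, smul_eq_mul] at hconv
  linarith

theorem convexOn_sub_smul_le_of_le (hf : ConvexOn ℝ univ f) {ε t : ℝ} (ht : 0 < t) (htε : t ≤ ε)
    {x d : F} (h : f (x - ε • d) ≤ f x) : f (x - t • d) ≤ f x :=
  sub_nonpos.1 <| (convexOn_sub_smul_sub_le hf (ht.trans_le htε) ht.le htε x d).trans <|
    mul_nonpos_of_nonneg_of_nonpos (div_nonneg ht.le (ht.trans_le htε).le) (sub_nonpos.2 h)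

theorem sub_half_smul_sub_eq_midpoint (a b : F) :
    a - (1 / 2 : ℝ) • (a - b) = midpoint ℝ a b := by
  rw [midpoint_eq_smul_add, invOf_eq_inv]
  module

theorem convexOn_two_mul_midpoint_le (hf : ConvexOn ℝ univ f) (a b : F) :
    2 * f (midpoint ℝ a b) ≤ f a + f b := by
  have h := hf.2 (mem_univ a) (mem_univ b) (by norm_num : (0 : ℝ) ≤ 1 / 2)
    (by norm_num : (0 : ℝ) ≤ 1 / 2) (by norm_num)
  rw [← smul_add, one_div, ← invOf_eq_inv, ← midpoint_eq_smul_add] at h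
  simp only [smul_eq_mul, invOf_eq_inv] at h
  linarith

theorem strictConvexOn_two_mul_midpoint_lt {s : Set F} (hf : StrictConvexOn ℝ s f) {a b : F}
    (ha : a ∈ s) (hb : b ∈ s) (hab : a ≠ b) : 2 * f (midpoint ℝ a b) < f a + f b := by
  have h := hf.2 ha hb hab (by norm_num : (0 : ℝ) < 1 / 2) (by norm_num : (0 : ℝ) < 1 / 2)
    (by norm_num)
  rw [← smul_add, one_div, ← invOf_eq_inv, ← midpoint_eq_smul_add] at h
  simp only [smul_eq_mul, invOf_eq_inv] at h
  linarith

theorem convexOn_comp_of_monotoneOn_Ici {φ : ℝ → ℝ} (hφ : ConvexOn ℝ (Ici 0) φ)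
    (hφm : MonotoneOn φ (Ici 0)) (hf : ConvexOn ℝ univ f) (hf0 : ∀ x, 0 ≤ f x) :
    ConvexOn ℝ univ fun x => φ (f x) := by
  refine ⟨convex_univ, fun x _ y _ s t hs ht hst => ?_⟩
  exact (hφm (hf0 _) (hφ.1 (hf0 x) (hf0 y) hs ht hst)
    (hf.2 (mem_univ x) (mem_univ y) hs ht hst)).trans (hφ.2 (hf0 x) (hf0 y) hs ht hst)

theorem two_mul_comp_midpoint_lt {φ : ℝ → ℝ} (hφ : StrictConvexOn ℝ (Ici 0) φ)
    (hφm : MonotoneOn φ (Ici 0)) (hf : ConvexOn ℝ univ f) (hf0 : ∀ x, 0 ≤ f x) {a b : F}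
    (hab : f a ≠ f b) : 2 * φ (f (midpoint ℝ a b)) < φ (f a) + φ (f b) := by
  refine lt_of_le_of_lt ?_ (strictConvexOn_two_mul_midpoint_lt hφ (hf0 a) (hf0 b) hab)
  have hmid : f (midpoint ℝ a b) ≤ midpoint ℝ (f a) (f b) := by
    rw [midpoint_eq_smul_add ℝ (f a), smul_eq_mul, invOf_eq_inv]
    linarith [convexOn_two_mul_midpoint_le hf a b]
  have := hφm (hf0 _) ((hf0 _).trans hmid) hmid
  gcongr

theorem convexOn_eventually_add_lt [TopologicalSpace F] [IsTopologicalAddGroup F]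
    [ContinuousConstSMul ℝ F] (hf : ConvexOn ℝ univ f) (hfc : Continuous f) {a b : F}
    (hlt : 2 * f (midpoint ℝ a b) < f a + f b) :
    ∀ᶠ q : ℝ × F × F in 𝓝[>] 0 ×ˢ 𝓝 a ×ˢ 𝓝 b,
      f (q.2.1 - q.1 • (a - b)) + f (q.2.2 + q.1 • (a - b)) < f q.2.1 + f q.2.2 := by
  have hhalf : ∀ᶠ z : F × F in 𝓝 a ×ˢ 𝓝 b,
      f (z.1 - (1 / 2 : ℝ) • (a - b)) + f (z.2 + (1 / 2 : ℝ) • (a - b)) < f z.1 + f z.2 := by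
    have hb : b + (1 / 2 : ℝ) • (a - b) = midpoint ℝ a b := by
      rw [← sub_half_smul_sub_eq_midpoint]; module
    rw [← nhds_prod_eq]
    refine (isOpen_lt (by fun_prop) (by fun_prop)).mem_nhds ?_
    rwa [mem_ofPred_eq, sub_half_smul_sub_eq_midpoint, hb, ← two_mul]
  filter_upwards [prod_mem_prod (Ioc_mem_nhdsGT (one_half_pos (α := ℝ))) hhalf]
    with ⟨t, z, w⟩ ⟨⟨ht, ht2⟩, hzw⟩
  have hz := convexOn_sub_smul_sub_le hf one_half_pos ht.le ht2 z (a - b)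
  have hw := convexOn_sub_smul_sub_le hf one_half_pos ht.le ht2 w (-(a - b))
  simp only [smul_neg, sub_neg_eq_add, mem_ofPred_eq] at hw hzw ht
  nlinarith [mul_pos (show 0 < t / (1 / 2) by positivity) (sub_pos.2 hzw)]

end Convexity

theorem strictConvexOn_norm_rpow {F : Type*} [NormedAddCommGroup F] [NormedSpace ℝ F]
    [StrictConvexSpace ℝ F] {q : ℝ} (hq : 1 < q) :
    StrictConvexOn ℝ univ fun x : F => ‖x‖ ^ q := by
  refine ⟨convex_univ, fun x _ y _ hxy s t hs ht hst => ?_⟩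
  by_cases hnorm : ‖x‖ = ‖y‖
  · have hlt : ‖s • x + t • y‖ < ‖y‖ := norm_combo_lt_of_ne hnorm.le le_rfl hxy hs ht hst
    calc ‖s • x + t • y‖ ^ q < ‖y‖ ^ q := Real.rpow_lt_rpow (norm_nonneg _) hlt (by linarith)
      _ = s • ‖x‖ ^ q + t • ‖y‖ ^ q := by rw [hnorm, ← add_smul, hst, one_smul]
  · calc ‖s • x + t • y‖ ^ q ≤ (s • ‖x‖ + t • ‖y‖) ^ q := Real.rpow_le_rpow (norm_nonneg _)
          (convexOn_univ_norm.2 trivial trivial hs.le ht.le hst) (by linarith)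
      _ < s • ‖x‖ ^ q + t • ‖y‖ ^ q :=
        (strictConvexOn_rpow hq).2 (norm_nonneg x) (norm_nonneg y) hnorm hs ht hst

section CylinderLike

variable {N : ℕ} {g : E N → ℝ}

theorem continuous_of_convexOn_univ (hg : ConvexOn ℝ univ g) : Continuous g :=
  continuousOn_univ.1 (hg.continuousOn isOpen_univ)

theorem continuous_seminorm (n : Seminorm ℝ (E N)) : Continuous n :=
  continuous_of_convexOn_univ n.convexOn

theorem CylinderLike.of_eventually (hg0 : ∀ x, 0 ≤ g x) (hg : ConvexOn ℝ univ g)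
    (h : ∀ a b : E N, a ≠ b → g a = g b →
      ∃ ε : ℝ, 0 < ε ∧ ∀ᶠ x in 𝓝 a, g (x - ε • (a - b)) ≤ g x) : CylinderLike g := by
  refine ⟨hg0, hg, fun a b hne heq => ?_⟩
  obtain ⟨ε, hε, ha⟩ := h a b hne heq
  obtain ⟨ε', hε', hb⟩ := h b a hne.symm heq.symm
  obtain ⟨δ, hδ, ha⟩ := Metric.eventually_nhds_iff_ball.1 ha
  obtain ⟨δ', hδ', hb⟩ := Metric.eventually_nhds_iff_ball.1 hb
  have hpos : 0 < min ε ε' := lt_min hε hε'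
  refine ⟨min ε ε', hpos, min δ δ', lt_min hδ hδ', fun x hx => ?_, fun y hy => ?_⟩
  · exact convexOn_sub_smul_le_of_le hg hpos (min_le_left _ _)
      (ha x (Metric.ball_subset_ball (min_le_left _ _) hx))
  · rw [← neg_sub b a, smul_neg, ← sub_eq_add_neg]
    exact convexOn_sub_smul_le_of_le hg hpos (min_le_right _ _)
      (hb y (Metric.ball_subset_ball (min_le_right _ _) hy))

theorem CylinderLike.eventually_sub_smul_le (hg : CylinderLike g) {a b : E N} (hab : a ≠ b)
    (heq : g a = g b) : ∀ᶠ q : ℝ × E N in 𝓝[>] 0 ×ˢ 𝓝 a, g (q.2 - q.1 • (a - b)) ≤ g q.2 := by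
  obtain ⟨ε, hε, δ, hδ, h, -⟩ := hg.2.2 a b hab heq
  filter_upwards [prod_mem_prod (Ioc_mem_nhdsGT hε) (Metric.ball_mem_nhds a hδ)] with q hq
  exact convexOn_sub_smul_le_of_le hg.2.1 hq.1.1 hq.1.2 (h q.2 hq.2)

theorem CylinderLike.eventually_lex_lt (hg : CylinderLike g) {φ : ℝ → ℝ} {k : E N → ℝ}
    (hφ : StrictConvexOn ℝ (Ici 0) φ) (hφm : MonotoneOn φ (Ici 0)) (hk : StrictConvexOn ℝ univ k)
    {a b : E N} (hab : a ≠ b) : ∀ᶠ q : ℝ × E N × E N in 𝓝[>] 0 ×ˢ 𝓝 a ×ˢ 𝓝 b,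
      toLex (φ (g (q.2.1 - q.1 • (a - b))) + φ (g (q.2.2 + q.1 • (a - b))),
        k (q.2.1 - q.1 • (a - b)) + k (q.2.2 + q.1 • (a - b))) <
      toLex (φ (g q.2.1) + φ (g q.2.2), k q.2.1 + k q.2.2) := by
  simp only [Prod.Lex.toLex_lt_toLex]
  by_cases heq : g a = g b
  · have hle_a : ∀ᶠ q : ℝ × E N × E N in 𝓝[>] 0 ×ˢ 𝓝 a ×ˢ 𝓝 b,
        g (q.2.1 - q.1 • (a - b)) ≤ g q.2.1 :=
      (tendsto_fst.prodMk (tendsto_fst.comp tendsto_snd)).eventually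
        (hg.eventually_sub_smul_le hab heq)
    have hle_b : ∀ᶠ q : ℝ × E N × E N in 𝓝[>] 0 ×ˢ 𝓝 a ×ˢ 𝓝 b,
        g (q.2.2 - q.1 • (b - a)) ≤ g q.2.2 :=
      (tendsto_fst.prodMk (tendsto_snd.comp tendsto_snd)).eventually
        (hg.eventually_sub_smul_le hab.symm heq.symm)
    filter_upwards [hle_a, hle_b, convexOn_eventually_add_lt hk.convexOn
      (continuous_of_convexOn_univ hk.convexOn)
      (strictConvexOn_two_mul_midpoint_lt hk (mem_univ a) (mem_univ b) hab)] with q hqa hqb hqk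
    rw [← neg_sub a b, smul_neg, sub_neg_eq_add] at hqb
    exact Prod.Lex.toLex_lt_toLex.1 <| Prod.Lex.toLex_strictMono <| Prod.mk_lt_mk_of_le_of_lt
      (add_le_add (hφm (hg.1 _) (hg.1 _) hqa) (hφm (hg.1 _) (hg.1 _) hqb)) hqk
  · have hφg := convexOn_comp_of_monotoneOn_Ici hφ.convexOn hφm hg.2.1 hg.1
    exact (convexOn_eventually_add_lt hφg (continuous_of_convexOn_univ hφg)
      (two_mul_comp_midpoint_lt hφ hφm hg.2.1 hg.1 heq)).mono fun _ => Or.inl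

end CylinderLike

section Crystalline

theorem eventually_linear_sub_smul_le {F : Type*} [AddCommGroup F] [Module ℝ F]
    [TopologicalSpace F] [IsTopologicalAddGroup F] [ContinuousSMul ℝ F] {g : F → ℝ}
    (hg : Continuous g) {ℓ : F →L[ℝ] ℝ} (hℓ : ∀ x, ℓ x ≤ g x) {a b : F} (hab : g b ≤ g a) :
    ∀ᶠ q : ℝ × F in 𝓝[>] 0 ×ˢ 𝓝 a, ℓ (q.2 - q.1 • (a - b)) ≤ g q.2 := by
  rcases (hℓ a).lt_or_eq with hlt | heq
  · have hopen : IsOpen {q : ℝ × F | ℓ (q.2 - q.1 • (a - b)) < g q.2} :=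
      isOpen_lt (by fun_prop) (by fun_prop)
    have hnhds : 𝓝[>] (0 : ℝ) ×ˢ 𝓝 a ≤ 𝓝 (0, a) := by
      rw [nhds_prod_eq]
      exact prod_mono_left _ nhdsWithin_le_nhds
    filter_upwards [hnhds (hopen.mem_nhds (by simpa using hlt))] with q (hq : ℓ _ < g _) using hq.le
  · filter_upwards [prod_mem_prod self_mem_nhdsWithin univ_mem] with q hq
    have hstep : 0 ≤ q.1 * (ℓ a - ℓ b) :=
      mul_nonneg hq.1.le (sub_nonneg.2 ((hℓ b).trans (hab.trans_eq heq.symm)))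
    rw [map_sub, map_smul, map_sub, smul_eq_mul]
    linarith [hℓ q.2]

variable {N : ℕ} {V : Finset (E N)}

theorem abs_inner_le_crystalline {v : E N} (hv : v ∈ V) (x : E N) :
    |inner ℝ v x| ≤ crystalline V x :=
  Seminorm.le_finset_sup_apply (p := fun v => (normSeminorm ℝ ℝ).comp (innerₗ (E N) v)) hv

theorem crystalline_le {x : E N} {r : ℝ} (hr : 0 ≤ r) (h : ∀ v ∈ V, |inner ℝ v x| ≤ r) :
    crystalline V x ≤ r :=
  Seminorm.finset_sup_apply_le hr h

theorem isNorm_crystalline (hV : Submodule.span ℝ (V : Set (E N)) = ⊤) :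
    IsNorm (crystalline V) := by
  intro x hx
  have hker : Submodule.span ℝ (V : Set (E N)) ≤ LinearMap.ker (innerₗ (E N) x) := by
    refine Submodule.span_le.2 fun v hv => ?_
    rw [SetLike.mem_coe, LinearMap.mem_ker, innerₗ_apply_apply, real_inner_comm]
    exact abs_nonpos_iff.1 ((abs_inner_le_crystalline hv x).trans_eq hx)
  rw [hV] at hker
  exact inner_self_eq_zero.1 (LinearMap.mem_ker.1 (hker Submodule.mem_top))

theorem cylinderLike_crystalline (V : Finset (E N)) : CylinderLike (crystalline V) := by
  refine CylinderLike.of_eventually (apply_nonneg _) (crystalline V).convexOn fun a b _ hab => ?_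
  have hcont := continuous_seminorm (crystalline V)
  have hstep : ∀ᶠ q : ℝ × E N in 𝓝[>] 0 ×ˢ 𝓝 a, ∀ v ∈ V,
      |inner ℝ v (q.2 - q.1 • (a - b))| ≤ crystalline V q.2 := by
    refine (eventually_all_finset V).2 fun v hv => ?_
    have hpos := eventually_linear_sub_smul_le hcont (ℓ := innerSL ℝ v)
      (fun x => (le_abs_self _).trans (abs_inner_le_crystalline hv x)) hab.ge
    have hneg := eventually_linear_sub_smul_le hcont (ℓ := -innerSL ℝ v)
      (fun x => (neg_le_abs _).trans (abs_inner_le_crystalline hv x)) hab.ge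
    filter_upwards [hpos, hneg] with q hq hq' using abs_le'.2 ⟨hq, hq'⟩
  obtain ⟨ε, hball, hε⟩ := (hstep.curry.and self_mem_nhdsWithin).exists
  exact ⟨ε, hε, hball.mono fun x hx => crystalline_le (apply_nonneg _ _) hx⟩

end Crystalline

section Planar

variable {F : Type*} [AddCommGroup F] [Module ℝ F]

theorem add_mul_le_seminorm_of_midpoint {n : Seminorm ℝ F} {x y : F} {m : ℝ} (hx : n x = m)
    (hy : n y = m) (hmid : n (midpoint ℝ x y) = m) {a : ℝ} (ha : 0 ≤ a) (b : ℝ) :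
    (a + b) * m ≤ n (a • x + b • y) := by
  have hsum : ∀ s : ℝ, 0 ≤ s → n (s • (x + y)) = s * (2 * m) := fun s hs => by
    have : s • (x + y) = (s * 2) • midpoint ℝ x y := by
      rw [← sub_half_smul_sub_eq_midpoint]
      module
    rw [this, map_smul_eq_mul, hmid, Real.norm_of_nonneg (by linarith), mul_assoc]
  rcases le_total b a with hb | hb
  · have htri := map_add_le_add n (a • x + b • y) ((a - b) • y)
    rw [show a • x + b • y + (a - b) • y = a • (x + y) by module, hsum a ha, map_smul_eq_mul, hy,
      Real.norm_of_nonneg (by linarith)] at htri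
    linarith
  · have htri := map_add_le_add n (a • x + b • y) ((b - a) • x)
    rw [show a • x + b • y + (b - a) • x = b • (x + y) by module, hsum b (ha.trans hb),
      map_smul_eq_mul, hx, Real.norm_of_nonneg (by linarith)] at htri
    linarith

theorem linearIndependent_of_seminorm_midpoint {n : Seminorm ℝ F} {x y : F} (hne : x ≠ y)
    (heq : n x = n y) (hmid : n (midpoint ℝ x y) = n x) (hx : n x ≠ 0) :
    LinearIndependent ℝ ![x, y] := by
  have hx0 : x ≠ 0 := fun h => hx (by rw [h, map_zero])
  refine (LinearIndependent.pair_iff' hx0).2 ?_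
  rintro r rfl
  have hr : |r| = 1 := by
    rw [map_smul_eq_mul, Real.norm_eq_abs] at heq
    exact (mul_eq_right₀ hx).1 heq.symm
  rcases eq_or_eq_neg_of_abs_eq hr with rfl | rfl
  · exact hne (one_smul ℝ x).symm
  · rw [neg_one_smul, midpoint_self_neg, map_zero] at hmid
    exact hx hmid.symm

theorem exists_coord_of_linearIndependent_pair {K W : Type*} [Field K] [AddCommGroup W]
    [Module K W] (hW : Module.finrank K W = 2) {x y : W} (hli : LinearIndependent K ![x, y]) :
    ∃ α β : W →ₗ[K] K, α x = 1 ∧ β x = 0 ∧ ∀ z, z = α z • x + β z • y := by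
  let B := basisOfLinearIndependentOfCardEqFinrank hli (by simp [hW])
  have hB0 : B 0 = x := by simp [B]
  have hB1 : B 1 = y := by simp [B]
  refine ⟨B.coord 0, B.coord 1, by simp [← hB0], by simp [← hB0], fun z => ?_⟩
  conv_lhs => rw [← B.sum_repr z, Fin.sum_univ_two, hB0, hB1]
  rfl

theorem eventually_sub_half_smul_le_of_midpoint {n : Seminorm ℝ (E 2)} {x y : E 2} (hne : x ≠ y)
    (heq : n x = n y) (hmid : n (midpoint ℝ x y) = n x) (hx : n x ≠ 0) :
    ∀ᶠ z in 𝓝 x, n (z - (1 / 2 : ℝ) • (x - y)) ≤ n z := by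
  obtain ⟨α, β, hα, hβ, hcoord⟩ := exists_coord_of_linearIndependent_pair (by simp)
    (linearIndependent_of_seminorm_midpoint hne heq hmid hx)
  have hαz : ∀ᶠ z in 𝓝 x, 1 / 2 < α z :=
    (α.continuous_of_finiteDimensional.tendsto x).eventually_const_lt (by rw [hα]; norm_num)
  have hβz : ∀ᶠ z in 𝓝 x, -1 / 2 < β z :=
    (β.continuous_of_finiteDimensional.tendsto x).eventually_const_lt (by rw [hβ]; norm_num)
  filter_upwards [hαz, hβz] with z hαz hβz
  calc n (z - (1 / 2 : ℝ) • (x - y)) = n ((α z - 1 / 2) • x + (β z + 1 / 2) • y) := by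
        conv_lhs => rw [hcoord z]
        congr 1
        module
    _ ≤ n ((α z - 1 / 2) • x) + n ((β z + 1 / 2) • y) := map_add_le_add n _ _
    _ = (α z + β z) * n x := by
        rw [map_smul_eq_mul, map_smul_eq_mul, ← heq, Real.norm_of_nonneg (by linarith),
          Real.norm_of_nonneg (by linarith)]
        ring
    _ ≤ n (α z • x + β z • y) :=
        add_mul_le_seminorm_of_midpoint rfl heq.symm hmid (by linarith) _
    _ = n z := by rw [← hcoord z]

theorem cylinderLike_seminorm_two (n : Seminorm ℝ (E 2)) : CylinderLike n := by
  refine CylinderLike.of_eventually (apply_nonneg n) n.convexOn fun x y hne heq => ?_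
  by_cases hx : n x = 0
  · have hxy : n (x - y) ≤ 0 := by simpa [← heq, hx] using map_sub_le_add n x y
    refine ⟨1, one_pos, .of_forall fun z => (map_sub_le_add n _ _).trans ?_⟩
    rw [one_smul]
    linarith
  refine ⟨1 / 2, one_half_pos, ?_⟩
  have hmid_le : n (midpoint ℝ x y) ≤ n x := by
    linarith [convexOn_two_mul_midpoint_le n.convexOn x y]
  rcases hmid_le.lt_or_eq with hlt | hmid
  · have hcont := continuous_seminorm n
    rw [← sub_half_smul_sub_eq_midpoint] at hlt
    exact ((hcont.comp (continuous_sub_right _)).continuousAt.eventually_lt hcont.continuousAt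
      hlt).mono fun z => le_of_lt
  · exact eventually_sub_half_smul_le_of_midpoint hne heq hmid hx

end Planar

section Existence

variable {Ω : Type*} [MeasurableSpace Ω] [TopologicalSpace Ω] [OpensMeasurableSpace Ω]
  {c : Ω → ℝ≥0∞}

theorem continuous_lintegral_of_le (hc : Continuous c) {C : NNReal} (hC : ∀ z, c z ≤ C) :
    Continuous fun π : ProbabilityMeasure Ω => ∫⁻ z, c z ∂(π : Measure Ω) := by
  have hne : ∀ z, c z ≠ ∞ := fun z => ((hC z).trans_lt ENNReal.coe_lt_top).ne
  have hle : ∀ z, (c z).toNNReal ≤ C := fun z =>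
    ENNReal.toNNReal_mono ENNReal.coe_ne_top (hC z)
  let f : BoundedContinuousFunction Ω NNReal := .mkOfBound
    ⟨fun z => (c z).toNNReal, ENNReal.continuousOn_toNNReal.comp_continuous hc hne⟩ C fun x y =>
      abs_sub_le_of_nonneg_of_le (NNReal.coe_nonneg _) (hle x) (NNReal.coe_nonneg _) (hle y)
  have hf : ∀ π : ProbabilityMeasure Ω, ∫⁻ z, c z ∂(π : Measure Ω) = ∫⁻ z, f z ∂(π : Measure Ω) :=
    fun π => lintegral_congr fun z => (ENNReal.coe_toNNReal (hne z)).symm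
  simp_rw [hf]
  exact continuous_iff_continuousAt.2 fun π =>
    ProbabilityMeasure.tendsto_iff_forall_lintegral_tendsto.1 tendsto_id f

theorem lowerSemicontinuous_lintegral (hc : Continuous c) :
    LowerSemicontinuous fun π : ProbabilityMeasure Ω => ∫⁻ z, c z ∂(π : Measure Ω) := by
  have htrunc : ∀ π : ProbabilityMeasure Ω, ∫⁻ z, c z ∂(π : Measure Ω) =
      ⨆ n : ℕ, ∫⁻ z, min (c z) n ∂(π : Measure Ω) := fun π => by
    rw [← lintegral_iSup (fun n => hc.measurable.min measurable_const)
      (fun i j hij z => min_le_min_left _ (by exact_mod_cast hij))]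
    refine lintegral_congr fun z => ?_
    rw [← inf_iSup_eq, ENNReal.iSup_natCast, inf_top_eq]
  simp_rw [htrunc]
  exact lowerSemicontinuous_iSup fun n =>
    (continuous_lintegral_of_le (C := n) (hc.min continuous_const)
      fun z => min_le_right _ _).lowerSemicontinuous

theorem isCompact_isMinOn {X β : Type*} [TopologicalSpace X] [LinearOrder β] {s : Set X}
    {f : X → β} (hs : IsCompact s) (hf : LowerSemicontinuous f) :
    IsCompact {x ∈ s | IsMinOn f s x} := by
  rcases s.eq_empty_or_nonempty with rfl | hne
  · simp
  obtain ⟨x₀, hx₀, hmin⟩ := (hf.lowerSemicontinuousOn s).exists_isMinOn hne hs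
  have heq : {x ∈ s | IsMinOn f s x} = s ∩ f ⁻¹' Iic (f x₀) := by
    ext x
    exact ⟨fun h => ⟨h.1, h.2 hx₀⟩, fun h => ⟨h.1, fun y hy => h.2.trans (hmin hy)⟩⟩
  rw [heq]
  exact hs.inter_right (hf.isClosed_preimage _)

variable {N : ℕ} {μ ν : Measure (E N)}

theorem prod_mem_adm [IsProbabilityMeasure μ] [IsProbabilityMeasure ν] : μ.prod ν ∈ Adm μ ν :=
  ⟨inferInstance, by simp, by simp⟩

theorem isClosed_adm [IsProbabilityMeasure μ] [IsProbabilityMeasure ν] :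
    IsClosed (((↑) : ProbabilityMeasure (E N × E N) → Measure (E N × E N)) ⁻¹' Adm μ ν) := by
  have hmarginals : ((↑) : ProbabilityMeasure (E N × E N) → Measure (E N × E N)) ⁻¹' Adm μ ν =
      {π | π.map measurable_fst.aemeasurable = ⟨μ, inferInstance⟩} ∩
        {π | π.map measurable_snd.aemeasurable = ⟨ν, inferInstance⟩} := by
    ext π
    exact ⟨fun h => ⟨Subtype.ext h.2.1, Subtype.ext h.2.2⟩,
      fun h => ⟨inferInstance, congrArg Subtype.val h.1, congrArg Subtype.val h.2⟩⟩
  rw [hmarginals]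
  exact (isClosed_eq (ProbabilityMeasure.continuous_map continuous_fst) continuous_const).inter
    (isClosed_eq (ProbabilityMeasure.continuous_map continuous_snd) continuous_const)

theorem isTightMeasureSet_adm [IsFiniteMeasure μ] [IsFiniteMeasure ν] :
    IsTightMeasureSet (Adm μ ν) := by
  refine .prodMk ((isTightMeasureSet_singleton (μ := μ)).subset ?_)
    ((isTightMeasureSet_singleton (μ := ν)).subset ?_)
  · rintro _ ⟨π, hπ, rfl⟩
    exact hπ.2.1
  · rintro _ ⟨π, hπ, rfl⟩
    exact hπ.2.2

theorem isCompact_adm [IsProbabilityMeasure μ] [IsProbabilityMeasure ν] :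
    IsCompact (((↑) : ProbabilityMeasure (E N × E N) → Measure (E N × E N)) ⁻¹' Adm μ ν) := by
  have hcompact := isCompact_closure_of_isTightMeasureSet
    (S := ((↑) : ProbabilityMeasure (E N × E N) → Measure (E N × E N)) ⁻¹' Adm μ ν)
    (isTightMeasureSet_adm.subset (by rintro _ ⟨π, hπ, rfl⟩; exact hπ))
  rwa [isClosed_adm.closure_eq] at hcompact

/-- Plans that minimise a secondary cost `k` among the optimal plans for the cost `c`. The paper's
`Π₂` is `SecondaryPlans c sqDist`; other costs `k` are needed when `sqDist` has infinite cost. -/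
def SecondaryPlans (c k : E N → E N → ℝ≥0∞) (μ ν : Measure (E N)) : Set (Measure (E N × E N)) :=
  {π | π ∈ Plans₁ c μ ν ∧ ∀ π' ∈ Plans₁ c μ ν, planCost k π ≤ planCost k π'}

theorem plans₁_preimage_coe (c : E N → E N → ℝ≥0∞) (μ ν : Measure (E N)) :
    ((↑) : ProbabilityMeasure (E N × E N) → Measure (E N × E N)) ⁻¹' Plans₁ c μ ν =
      {π ∈ ((↑) : ProbabilityMeasure (E N × E N) → Measure (E N × E N)) ⁻¹' Adm μ ν |
        IsMinOn (fun π : ProbabilityMeasure (E N × E N) => planCost c π) ((↑) ⁻¹' Adm μ ν) π} := by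
  ext π
  exact ⟨fun h => ⟨h.1, fun π' hπ' => h.2 π' hπ'⟩,
    fun h => ⟨h.1, fun π' hπ' => isMinOn_iff.1 h.2 ⟨π', hπ'.1⟩ hπ'⟩⟩

theorem secondaryPlans_nonempty [IsProbabilityMeasure μ] [IsProbabilityMeasure ν]
    {c k : E N → E N → ℝ≥0∞} (hc : Continuous fun z : E N × E N => c z.1 z.2)
    (hk : Continuous fun z : E N × E N => k z.1 z.2) : (SecondaryPlans c k μ ν).Nonempty := by
  have hlsc_c : LowerSemicontinuous fun π : ProbabilityMeasure (E N × E N) => planCost c π :=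
    lowerSemicontinuous_lintegral hc
  have hlsc_k : LowerSemicontinuous fun π : ProbabilityMeasure (E N × E N) => planCost k π :=
    lowerSemicontinuous_lintegral hk
  obtain ⟨π₁, hπ₁⟩ := (hlsc_c.lowerSemicontinuousOn _).exists_isMinOn
    ⟨⟨μ.prod ν, inferInstance⟩, prod_mem_adm⟩ (isCompact_adm (μ := μ) (ν := ν))
  obtain ⟨π, hπ, hmin⟩ := (hlsc_k.lowerSemicontinuousOn _).exists_isMinOn ⟨π₁, hπ₁⟩
    (isCompact_isMinOn isCompact_adm hlsc_c)
  rw [← plans₁_preimage_coe] at hπ hmin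
  exact ⟨π, hπ, fun π' hπ' => isMinOn_iff.1 hmin ⟨π', hπ'.1.1⟩ hπ'⟩

end Existence

section Competitor

theorem toLex_lintegral_lt {Ω : Type*} [MeasurableSpace Ω] {γ : Measure Ω} (hγ : γ ≠ 0)
    {f f' g g' : Ω → ℝ≥0∞} (hf' : AEMeasurable f' γ) (hg' : AEMeasurable g' γ)
    (hf'top : ∫⁻ ω, f' ω ∂γ ≠ ∞) (hg'top : ∫⁻ ω, g' ω ∂γ ≠ ∞)
    (hlt : ∀ᵐ ω ∂γ, toLex (f ω, g ω) < toLex (f' ω, g' ω)) :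
    toLex (∫⁻ ω, f ω ∂γ, ∫⁻ ω, g ω ∂γ) < toLex (∫⁻ ω, f' ω ∂γ, ∫⁻ ω, g' ω ∂γ) := by
  simp only [Prod.Lex.toLex_lt_toLex] at hlt ⊢
  have hff' : f ≤ᵐ[γ] f' := hlt.mono fun ω h => h.elim le_of_lt fun h => h.1.le
  have hle := lintegral_mono_ae hff'
  refine hle.lt_or_eq.imp id fun heq => ⟨heq, ?_⟩
  have hae : f =ᵐ[γ] f' := ae_eq_of_ae_le_of_lintegral_le hff' (heq ▸ hf'top) hf' heq.ge
  have hgg' : ∀ᵐ ω ∂γ, g ω < g' ω := by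
    filter_upwards [hlt, hae] with ω hω heqω
    exact hω.elim (fun h => absurd heqω h.ne) And.right
  exact lintegral_strict_mono hγ hg'
    (ne_top_of_le_ne_top hg'top (lintegral_mono_ae (hgg'.mono fun _ => le_of_lt))) hgg'

variable {N : ℕ} {μ ν : Measure (E N)} {π m s : Measure (E N × E N)} {c k : E N → E N → ℝ≥0∞}

theorem toLex_planCost_le (hπ : π ∈ SecondaryPlans c k μ ν) {π' : Measure (E N × E N)}
    (hπ' : π' ∈ Adm μ ν) :
    toLex (planCost c π, planCost k π) ≤ toLex (planCost c π', planCost k π') := by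
  refine Prod.Lex.toLex_le_toLex.2 ((hπ.1.2 π' hπ').lt_or_eq.imp id fun heq => ⟨heq, ?_⟩)
  exact hπ.2 π' ⟨hπ', fun π'' hπ'' => heq.symm.trans_le (hπ.1.2 π'' hπ'')⟩

theorem sub_add_mem_adm (hπ : π ∈ Adm μ ν) (hm : m ≤ π) (hfst : m.map Prod.fst = s.map Prod.fst)
    (hsnd : m.map Prod.snd = s.map Prod.snd) : π - m + s ∈ Adm μ ν := by
  have := hπ.1
  have : IsFiniteMeasure m := isFiniteMeasure_of_le π hm
  have hadd : π - m + m = π := Measure.sub_add_cancel_of_le hm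
  have hfst' : (π - m + s).map Prod.fst = π.map Prod.fst := by
    rw [Measure.map_add _ _ measurable_fst, ← hfst, ← Measure.map_add _ _ measurable_fst, hadd]
  have hsnd' : (π - m + s).map Prod.snd = π.map Prod.snd := by
    rw [Measure.map_add _ _ measurable_snd, ← hsnd, ← Measure.map_add _ _ measurable_snd, hadd]
  have hprob : IsProbabilityMeasure ((π - m + s).map Prod.fst) := by
    rw [hfst']
    exact Measure.isProbabilityMeasure_map measurable_fst.aemeasurable
  exact ⟨Measure.isProbabilityMeasure_of_map Prod.fst, hfst'.trans hπ.2.1, hsnd'.trans hπ.2.2⟩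

theorem planCost_sub_add (c : E N → E N → ℝ≥0∞) [IsFiniteMeasure m] (hm : m ≤ π) :
    planCost c (π - m + s) + planCost c m = planCost c π + planCost c s := by
  conv_rhs => rw [← Measure.sub_add_cancel_of_le hm]
  simp only [planCost, lintegral_add_measure]
  ring

theorem toLex_planCost_le_of_le (hπ : π ∈ SecondaryPlans c k μ ν) (hc : planCost c π ≠ ∞)
    (hk : planCost k π ≠ ∞) (hm : m ≤ π) (hfst : m.map Prod.fst = s.map Prod.fst)
    (hsnd : m.map Prod.snd = s.map Prod.snd) :
    toLex (planCost c m, planCost k m) ≤ toLex (planCost c s, planCost k s) := by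
  have := hπ.1.1.1
  have : IsFiniteMeasure m := isFiniteMeasure_of_le π hm
  have hcm : planCost c m ≠ ∞ := ne_top_of_le_ne_top hc (lintegral_mono' hm le_rfl)
  have hlex := toLex_planCost_le hπ (sub_add_mem_adm hπ.1.1 hm hfst hsnd)
  simp only [Prod.Lex.toLex_le_toLex] at hlex ⊢
  refine hlex.imp (fun hlt => ?_) fun ⟨heq, hle⟩ => ⟨?_, ?_⟩
  · rw [← ENNReal.add_lt_add_iff_left hc, ← planCost_sub_add (s := s) c hm]
    exact ENNReal.add_lt_add_right hcm hlt
  · rw [← ENNReal.add_right_inj hc, ← planCost_sub_add (s := s) c hm, heq]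
  · rw [← ENNReal.add_le_add_iff_left hk, ← planCost_sub_add (s := s) k hm]
    gcongr

variable {Ω : Type*} [MeasurableSpace Ω] {γ : Measure Ω} {x x' y y' : Ω → E N}

theorem planCost_map_add_map (hc : Measurable fun z : E N × E N => c z.1 z.2)
    (hx : Measurable x) (hx' : Measurable x') (hy : Measurable y) (hy' : Measurable y') :
    planCost c (γ.map (fun ω => (x ω, y ω)) + γ.map fun ω => (x' ω, y' ω)) =
      ∫⁻ ω, c (x ω) (y ω) + c (x' ω) (y' ω) ∂γ := by
  rw [planCost, lintegral_add_measure, lintegral_map hc (hx.prodMk hy),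
    lintegral_map hc (hx'.prodMk hy')]
  exact (lintegral_add_left (hc.comp (hx.prodMk hy)) _).symm

theorem eq_zero_of_ae_swap_lt (hπ : π ∈ SecondaryPlans c k μ ν) (hcπ : planCost c π ≠ ∞)
    (hkπ : planCost k π ≠ ∞) (hc : Measurable fun z : E N × E N => c z.1 z.2)
    (hk : Measurable fun z : E N × E N => k z.1 z.2)
    (hx : Measurable x) (hx' : Measurable x') (hy : Measurable y) (hy' : Measurable y')
    (hle : γ.map (fun ω => (x ω, y ω)) + γ.map (fun ω => (x' ω, y' ω)) ≤ π)
    (hlt : ∀ᵐ ω ∂γ,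
      toLex (c (x' ω) (y ω) + c (x ω) (y' ω), k (x' ω) (y ω) + k (x ω) (y' ω)) <
        toLex (c (x ω) (y ω) + c (x' ω) (y' ω), k (x ω) (y ω) + k (x' ω) (y' ω))) :
    γ = 0 := by
  by_contra hγ
  have hopt := toLex_planCost_le_of_le hπ hcπ hkπ hle
    (s := γ.map (fun ω => (x' ω, y ω)) + γ.map fun ω => (x ω, y' ω))
    (by simp only [Measure.map_add _ _ measurable_fst, Measure.map_map measurable_fst,
          Function.comp_def, hx.prodMk hy, hx'.prodMk hy', hx'.prodMk hy, hx.prodMk hy', add_comm])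
    (by simp only [Measure.map_add _ _ measurable_snd, Measure.map_map measurable_snd,
          Function.comp_def, hx.prodMk hy, hx'.prodMk hy', hx'.prodMk hy, hx.prodMk hy'])
  have hfin : ∀ {f : E N → E N → ℝ≥0∞}, planCost f π ≠ ∞ →
      planCost f (γ.map (fun ω => (x ω, y ω)) + γ.map fun ω => (x' ω, y' ω)) ≠ ∞ :=
    fun hf => ne_top_of_le_ne_top hf (lintegral_mono' hle le_rfl)
  have hcm := hfin hcπ
  have hkm := hfin hkπ
  rw [planCost_map_add_map hc hx hx' hy hy'] at hcm
  rw [planCost_map_add_map hk hx hx' hy hy'] at hkm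
  rw [planCost_map_add_map hc hx hx' hy hy', planCost_map_add_map hk hx hx' hy hy',
    planCost_map_add_map hc hx' hx hy hy', planCost_map_add_map hk hx' hx hy hy'] at hopt
  have hmeas : ∀ {f : E N → E N → ℝ≥0∞}, (Measurable fun z : E N × E N => f z.1 z.2) →
      AEMeasurable (fun ω => f (x ω) (y ω) + f (x' ω) (y' ω)) γ := fun hf =>
    ((hf.comp (hx.prodMk hy)).add (hf.comp (hx'.prodMk hy'))).aemeasurable
  exact hopt.not_gt (toLex_lintegral_lt hγ (hmeas hc) (hmeas hk) hcm hkm hlt)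

end Competitor

section Translation

open scoped Pointwise

theorem exists_smul_restrict_le {Ω : Type*} [MeasurableSpace Ω] {μ ρ : Measure Ω}
    [μ.HaveLebesgueDecomposition ρ] (hμ : μ ≪ ρ) {A : Set Ω} (hA : MeasurableSet A)
    (hA0 : μ A ≠ 0) :
    ∃ B ⊆ A, MeasurableSet B ∧ ρ B ≠ 0 ∧ ∃ ε : ℝ≥0∞, ε ≠ 0 ∧ ε • ρ.restrict B ≤ μ := by
  have hdensity : Measurable (μ.rnDeriv ρ) := μ.measurable_rnDeriv ρ
  have hμ_eq : ρ.withDensity (μ.rnDeriv ρ) = μ := Measure.withDensity_rnDeriv_eq _ _ hμ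
  obtain ⟨n, hn⟩ : ∃ n : ℕ, ρ (A ∩ {x | (n : ℝ≥0∞)⁻¹ ≤ μ.rnDeriv ρ x}) ≠ 0 := by
    by_contra! hnull
    refine hA0 (measure_mono_null (fun x hx => ?_) (measure_union_null
      (hμ (measure_iUnion_null hnull)) (Measure.rnDeriv_pos hμ)))
    refine (em (0 < μ.rnDeriv ρ x)).elim (fun hpos => .inl ?_) .inr
    obtain ⟨n, hn⟩ := ENNReal.exists_inv_nat_lt hpos.ne'
    exact mem_iUnion.2 ⟨n, hx, hn.le⟩
  have hB : MeasurableSet (A ∩ {x | (n : ℝ≥0∞)⁻¹ ≤ μ.rnDeriv ρ x}) :=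
    hA.inter (measurableSet_le measurable_const hdensity)
  refine ⟨_, inter_subset_left, hB, hn, (n : ℝ≥0∞)⁻¹,
    ENNReal.inv_ne_zero.2 (ENNReal.natCast_ne_top n), ?_⟩
  rw [← withDensity_const, ← withDensity_indicator hB]
  refine (withDensity_mono (.of_forall fun x => ?_)).trans_eq hμ_eq
  exact indicator_apply_le fun hx => hx.2

variable {G : Type*} [AddCommGroup G] [TopologicalSpace G] [IsTopologicalAddGroup G]
  [LocallyCompactSpace G] [MeasurableSpace G] [BorelSpace G] {ρ : Measure G}
  [ρ.IsAddHaarMeasure] [ρ.InnerRegular]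

theorem eventually_measure_inter_preimage_add_ne_zero [T2Space G] {A : Set G}
    (hA : MeasurableSet A) (hA0 : ρ A ≠ 0) :
    ∀ᶠ v in 𝓝 0, ρ (A ∩ (· + v) ⁻¹' A) ≠ 0 := by
  obtain ⟨K, hKA, hK, hK0⟩ := hA.exists_lt_isCompact (pos_iff_ne_zero.2 hA0)
  filter_upwards [eventually_nhds_zero_measure_vadd_sdiff_lt (μ := ρ) hK hK.isClosed
    hK0.ne'] with v hv hnull
  have hinter : ρ ((v +ᵥ K) ∩ K) = 0 := by
    rw [← measure_preimage_add_right ρ v]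
    refine measure_mono_null (fun x hx => ?_) hnull
    refine ⟨hKA ?_, hKA hx.2⟩
    obtain ⟨y, hy, hyx⟩ := hx.1
    obtain rfl : y = x := add_left_cancel (hyx.trans (add_comm x v))
    exact hy
  have hsplit := measure_inter_add_sdiff (μ := ρ) (v +ᵥ K) hK.measurableSet
  rw [hinter, zero_add, measure_vadd] at hsplit
  exact hv.ne hsplit

theorem eventually_exists_add_map_add_le [T2Space G] [SigmaFinite ρ] {μ : Measure G} [SigmaFinite μ]
    (hμ : μ ≪ ρ) {A : Set G} (hA : MeasurableSet A) (hA0 : μ A ≠ 0) :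
    ∀ᶠ v in 𝓝 (0 : G), ∃ σ : Measure G, SFinite σ ∧ σ ≠ 0 ∧ σ + σ.map (· + v) ≤ μ ∧
      ∀ᵐ x ∂σ, x ∈ A ∧ x + v ∈ A := by
  obtain ⟨B, hBA, hB, hB0, ε, hε, hle⟩ := exists_smul_restrict_le hμ hA hA0
  filter_upwards [eventually_measure_inter_preimage_add_ne_zero hB hB0] with v hv
  have hS : MeasurableSet (B ∩ (· + v) ⁻¹' B) := hB.inter (measurable_add_const v hB)
  have hmap : (ρ.restrict (B ∩ (· + v) ⁻¹' B)).map (· + v) ≤ ρ.restrict B := by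
    refine (Measure.map_mono (Measure.restrict_mono_set _ inter_subset_right)
      (measurable_add_const v)).trans_eq ?_
    rw [← Measure.restrict_map (measurable_add_const v) hB, map_add_right_eq_self]
  refine ⟨(ε / 2) • ρ.restrict (B ∩ (· + v) ⁻¹' B), inferInstance, ?_, ?_, ?_⟩
  · simp [hε, hv]
  · calc (ε / 2) • ρ.restrict (B ∩ (· + v) ⁻¹' B) +
          ((ε / 2) • ρ.restrict (B ∩ (· + v) ⁻¹' B)).map (· + v)
        ≤ (ε / 2) • ρ.restrict B + (ε / 2) • ρ.restrict B := by
          rw [Measure.map_smul]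
          gcongr
          exact inter_subset_left
      _ = ε • ρ.restrict B := by rw [← add_smul, ENNReal.add_halves]
      _ ≤ μ := hle
  · exact Measure.ae_smul_measure ((ae_restrict_mem hS).mono fun x hx => ⟨hBA hx.1, hBA hx.2⟩) _

end Translation

section Coupling

variable {X Y : Type*} [MeasurableSpace X] [MeasurableSpace Y] {μ σ : Measure X} [SFinite σ]
  {κ : Kernel X Y}

theorem compProd_mono_left [SFinite μ] [IsSFiniteKernel κ] (h : σ ≤ μ) : σ ⊗ₘ κ ≤ μ ⊗ₘ κ :=
  Measure.le_iff.2 fun s hs => by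
    simpa only [Measure.compProd_apply hs] using lintegral_mono' h le_rfl

theorem compProd_comap_map_prodMap [IsSFiniteKernel κ] {τ : X → X} (hτ : Measurable τ) :
    (σ ⊗ₘ κ.comap τ hτ).map (Prod.map τ id) = σ.map τ ⊗ₘ κ := by
  ext s hs
  rw [Measure.map_apply (hτ.prodMap measurable_id) hs, Measure.compProd_apply hs,
    Measure.compProd_apply (hτ.prodMap measurable_id hs),
    lintegral_map (Kernel.measurable_kernel_prodMk_left hs) hτ]
  rfl

theorem compProd_prod_map_fst {η : Kernel X Y} [IsSFiniteKernel κ] [IsMarkovKernel η] :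
    (σ ⊗ₘ (κ ×ₖ η)).map (fun p => (p.1, p.2.1)) = σ ⊗ₘ κ := by
  conv_rhs => rw [← Kernel.fst_prod κ η, Kernel.fst_eq, Measure.compProd_map measurable_fst]
  rfl

theorem compProd_prod_comap_map_snd {η : Kernel X Y} [IsMarkovKernel η] [IsSFiniteKernel κ]
    {τ : X → X} (hτ : Measurable τ) :
    (σ ⊗ₘ (η ×ₖ κ.comap τ hτ)).map (fun p => (τ p.1, p.2.2)) = σ.map τ ⊗ₘ κ := by
  conv_rhs =>
    rw [← compProd_comap_map_prodMap hτ, ← Kernel.snd_prod η (κ.comap τ hτ), Kernel.snd_eq,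
      Measure.compProd_map measurable_snd, Measure.map_map (by fun_prop) (by fun_prop)]
  rfl

theorem exists_coupling_of_add_map_le [SFinite μ] [IsMarkovKernel κ] {τ : X → X} (hτ : Measurable τ)
    (hσ0 : σ ≠ 0) (hσ : σ + σ.map τ ≤ μ) {S T : Set (X × Y)} (hS : MeasurableSet S)
    (hT : MeasurableSet T)
    (hpos : ∀ᵐ x ∂σ, κ x (Prod.mk x ⁻¹' S) ≠ 0 ∧ κ (τ x) (Prod.mk (τ x) ⁻¹' T) ≠ 0) :
    ∃ γ : Measure (X × Y × Y), γ ≠ 0 ∧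
      (∀ᵐ p ∂γ, (p.1, p.2.1) ∈ S ∧ (τ p.1, p.2.2) ∈ T) ∧
      γ.map (fun p => (p.1, p.2.1)) + γ.map (fun p => (τ p.1, p.2.2)) ≤ μ ⊗ₘ κ := by
  let γ := σ ⊗ₘ (κ ×ₖ κ.comap τ hτ)
  have hfst : Measurable fun p : X × Y × Y => (p.1, p.2.1) := by fun_prop
  have hsnd : Measurable fun p : X × Y × Y => (τ p.1, p.2.2) := by fun_prop
  let G := (fun p : X × Y × Y => (p.1, p.2.1)) ⁻¹' S ∩ (fun p => (τ p.1, p.2.2)) ⁻¹' T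
  have hG : MeasurableSet G := (hfst hS).inter (hsnd hT)
  refine ⟨γ.restrict G, ?_, ae_restrict_mem hG, ?_⟩
  · rw [Ne, Measure.restrict_eq_zero, Measure.compProd_apply hG,
      lintegral_eq_zero_iff (Kernel.measurable_kernel_prodMk_left hG)]
    intro hzero
    have := ae_neBot.2 hσ0
    obtain ⟨x, (hx : (κ ×ₖ κ.comap τ hτ) x (Prod.mk x ⁻¹' G) = 0), hxS, hxT⟩ :=
      (hzero.and hpos).exists
    rw [Kernel.prod_apply] at hx
    exact mul_ne_zero hxS hxT ((Measure.prod_prod _ _).symm.trans hx)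
  · calc (γ.restrict G).map (fun p => (p.1, p.2.1)) + (γ.restrict G).map (fun p => (τ p.1, p.2.2))
        ≤ γ.map (fun p => (p.1, p.2.1)) + γ.map (fun p => (τ p.1, p.2.2)) :=
          add_le_add (Measure.map_mono Measure.restrict_le_self hfst)
            (Measure.map_mono Measure.restrict_le_self hsnd)
      _ = (σ + σ.map τ) ⊗ₘ κ := by
          rw [compProd_prod_map_fst, compProd_prod_comap_map_snd, Measure.compProd_add_left]
      _ ≤ μ ⊗ₘ κ := compProd_mono_left hσ

end Coupling

section Displacement

theorem toLex_ofReal_lt_toLex_ofReal {a b a' b' : ℝ} (ha : 0 ≤ a) (hb : 0 ≤ b)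
    (h : toLex (a, b) < toLex (a', b')) :
    toLex (ENNReal.ofReal a, ENNReal.ofReal b) < toLex (ENNReal.ofReal a', ENNReal.ofReal b') := by
  simp only [Prod.Lex.toLex_lt_toLex] at h ⊢
  exact h.imp (ENNReal.ofReal_lt_ofReal_iff_of_nonneg ha).2 fun ⟨heq, hlt⟩ =>
    ⟨congrArg _ heq, (ENNReal.ofReal_lt_ofReal_iff_of_nonneg hb).2 hlt⟩

variable {N : ℕ}

/-- The transport cost `h (y - x)` determined by the displacement `y - x`. Negative values of `h`
are truncated to `0`. -/
noncomputable def dispCost (h : E N → ℝ) (x y : E N) : ℝ≥0∞ := ENNReal.ofReal (h (y - x))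

theorem continuous_dispCost {h : E N → ℝ} (hh : Continuous h) :
    Continuous fun z : E N × E N => dispCost h z.1 z.2 :=
  ENNReal.continuous_ofReal.comp (hh.comp (continuous_snd.sub continuous_fst))

theorem toLex_dispCost_swap_lt {h k : E N → ℝ} (h0 : ∀ x, 0 ≤ h x) (k0 : ∀ x, 0 ≤ k x)
    {x y y' v : E N}
    (hlt : toLex (h (y - x - v) + h (y' - (x + v) + v), k (y - x - v) + k (y' - (x + v) + v)) <
      toLex (h (y - x) + h (y' - (x + v)), k (y - x) + k (y' - (x + v)))) :
    toLex (dispCost h (x + v) y + dispCost h x y', dispCost k (x + v) y + dispCost k x y') <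
      toLex (dispCost h x y + dispCost h (x + v) y',
        dispCost k x y + dispCost k (x + v) y') := by
  have hofReal := toLex_ofReal_lt_toLex_ofReal (add_nonneg (h0 _) (h0 _))
    (add_nonneg (k0 _) (k0 _)) hlt
  simpa only [dispCost, ENNReal.ofReal_add (h0 _) (h0 _), ENNReal.ofReal_add (k0 _) (k0 _),
    ← sub_sub, sub_add_cancel] using hofReal

theorem ae_kernel_eq_zero_or_eq_zero {μ ν : Measure (E N)} [SigmaFinite μ] (hμ : μ ≪ volume)
    {κ : Kernel (E N) (E N)} [IsMarkovKernel κ] {h k : E N → ℝ} (hh : Continuous h)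
    (hk : Continuous k) (h0 : ∀ x, 0 ≤ h x) (k0 : ∀ x, 0 ≤ k x)
    (hκ : μ ⊗ₘ κ ∈ SecondaryPlans (dispCost h) (dispCost k) μ ν)
    (hfin : planCost (dispCost h) (μ ⊗ₘ κ) ≠ ∞) (kfin : planCost (dispCost k) (μ ⊗ₘ κ) ≠ ∞)
    {d : E N} {U V : Set (E N)} (hU : MeasurableSet U) (hV : MeasurableSet V)
    (hlt : ∀ᶠ t in 𝓝[>] (0 : ℝ), ∀ z ∈ U, ∀ w ∈ V,
      toLex (h (z - t • d) + h (w + t • d), k (z - t • d) + k (w + t • d)) <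
        toLex (h z + h w, k z + k w)) :
    ∀ᵐ x ∂μ, κ x ((· - x) ⁻¹' U) = 0 ∨ κ x ((· - x) ⁻¹' V) = 0 := by
  have hdisp : Measurable fun q : E N × E N => q.2 - q.1 := by fun_prop
  have hmeas : ∀ {W : Set (E N)}, MeasurableSet W →
      MeasurableSet {x | κ x ((· - x) ⁻¹' W) ≠ 0} := fun hW =>
    Kernel.measurable_kernel_prodMk_left (hdisp hW) (measurableSet_singleton 0).compl
  by_contra hpos
  have hA0 : μ ({x | κ x ((· - x) ⁻¹' U) ≠ 0} ∩ {x | κ x ((· - x) ⁻¹' V) ≠ 0}) ≠ 0 := fun hnull =>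
    hpos ((measure_eq_zero_iff_ae_notMem.1 hnull).mono fun x hx =>
      or_iff_not_and_not.2 fun hx' => hx hx')
  have htendsto : Tendsto (fun t : ℝ => t • d) (𝓝[>] 0) (𝓝 0) :=
    ((continuous_id.smul continuous_const).tendsto' 0 0 (zero_smul ℝ d)).mono_left
      nhdsWithin_le_nhds
  obtain ⟨t, ⟨σ, _, hσ0, hσ, hσA⟩, hlt_t⟩ := ((htendsto.eventually
    (eventually_exists_add_map_add_le hμ ((hmeas hU).inter (hmeas hV)) hA0)).and hlt).exists
  obtain ⟨γ, hγ0, hγUV, hγ⟩ := exists_coupling_of_add_map_le (κ := κ) (measurable_add_const (t • d))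
    hσ0 hσ (hdisp hU) (hdisp hV) (hσA.mono fun x hx => ⟨hx.1.1, hx.2.2⟩)
  refine hγ0 (eq_zero_of_ae_swap_lt hκ hfin kfin (continuous_dispCost hh).measurable
    (continuous_dispCost hk).measurable (by fun_prop) (by fun_prop) (by fun_prop) (by fun_prop)
    hγ (hγUV.mono fun p hp => ?_))
  exact toLex_dispCost_swap_lt h0 k0 (hlt_t _ hp.1 _ hp.2)

end Displacement

section Dirac

variable {Y : Type*} [MeasurableSpace Y]

theorem exists_eq_dirac_of_prod_diagonal_compl {m : Measure Y} [IsProbabilityMeasure m]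
    [MeasurableEq Y] (h : m.prod m (diagonal Y)ᶜ = 0) : ∃ y, m = Measure.dirac y := by
  obtain ⟨y, hy⟩ :=
    ((Measure.measure_prod_null measurableSet_diagonal.compl).1 h).exists
  have hconst : id =ᵐ[m] fun _ => y := measure_mono_null (fun x hx => Ne.symm hx) hy
  refine ⟨y, ?_⟩
  rw [← Measure.map_id (μ := m), Measure.map_congr hconst, Measure.map_const, measure_univ,
    one_smul]

theorem ae_exists_eq_dirac {X : Type*} [MeasurableSpace X] {μ : Measure X} [TopologicalSpace Y]
    [SecondCountableTopology Y] [MeasurableEq Y] {m : X → Measure Y}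
    [∀ x, IsProbabilityMeasure (m x)]
    (h : ∀ a b : Y, a ≠ b → ∃ U ∈ 𝓝 a, ∃ V ∈ 𝓝 b, ∀ᵐ x ∂μ, m x U = 0 ∨ m x V = 0) :
    ∀ᵐ x ∂μ, ∃ y, m x = Measure.dirac y := by
  choose! U hU V hV hUV using h
  obtain ⟨s, hs, hs_countable, hcover⟩ := TopologicalSpace.countable_cover_nhdsWithin
    (s := (diagonal Y)ᶜ) (f := fun q => U q.1 q.2 ×ˢ V q.1 q.2) fun q hq =>
      mem_nhdsWithin_of_mem_nhds (prod_mem_nhds (hU _ _ hq) (hV _ _ hq))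
  filter_upwards [(ae_ball_iff hs_countable).2 fun q hq => hUV q.1 q.2 (hs hq)] with x hx
  refine exists_eq_dirac_of_prod_diagonal_compl (measure_mono_null hcover ?_)
  refine (measure_biUnion_null_iff hs_countable).2 fun q hq => ?_
  rw [Measure.prod_prod]
  exact mul_eq_zero.2 (hx q hq)

variable {N : ℕ} {μ ν : Measure (E N)} {π : Measure (E N × E N)}

theorem inducedByMap_compProd [SFinite μ] {κ : Kernel (E N) (E N)} [IsMarkovKernel κ]
    (h : ∀ᵐ x ∂μ, ∃ y, κ x = Measure.dirac y) : InducedByMap μ (μ ⊗ₘ κ) := by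
  have hT : Measurable fun x => ∫ y, y ∂κ x :=
    (stronglyMeasurable_id.comp_measurable measurable_snd).integral_kernel_prod_right'.measurable
  refine ⟨_, hT.aemeasurable, ?_⟩
  rw [← Measure.compProd_deterministic hT]
  refine Measure.compProd_congr (h.mono fun x ⟨y, hy⟩ => ?_)
  rw [Kernel.deterministic_apply, hy, integral_dirac]

theorem CylinderLike.inducedByMap_of_mem_secondaryPlans {g : E N → ℝ} (hg : CylinderLike g)
    {φ : ℝ → ℝ} (hφ : StrictConvexOn ℝ (Ici 0) φ) (hφm : MonotoneOn φ (Ici 0)) (hφ0 : 0 ≤ φ 0)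
    {k : E N → ℝ} (hk : StrictConvexOn ℝ univ k) (k0 : ∀ x, 0 ≤ k x) (hμ : μ ≪ volume)
    (hπ : π ∈ SecondaryPlans (dispCost fun x => φ (g x)) (dispCost k) μ ν)
    (hfin : planCost (dispCost fun x => φ (g x)) π ≠ ∞) (kfin : planCost (dispCost k) π ≠ ∞) :
    InducedByMap μ π := by
  have := hπ.1.1.1
  have hfst : π.fst = μ := hπ.1.1.2.1
  have : IsFiniteMeasure μ := hfst ▸ inferInstance
  have hdisint : μ ⊗ₘ π.condKernel = π := by rw [← hfst, π.disintegrate]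
  rw [← hdisint] at hπ hfin kfin ⊢
  have hconv := convexOn_comp_of_monotoneOn_Ici hφ.convexOn hφm hg.2.1 hg.1
  have hnonneg : ∀ x, 0 ≤ φ (g x) := fun x =>
    hφ0.trans (hφm self_mem_Ici (hg.1 x) (hg.1 x))
  have hdirac : ∀ᵐ x ∂μ, ∃ y, (π.condKernel x).map (· - x) = Measure.dirac y := by
    have (x : E N) : IsProbabilityMeasure ((π.condKernel x).map (· - x)) :=
      Measure.isProbabilityMeasure_map (by fun_prop)
    refine ae_exists_eq_dirac fun a b hab => ?_
    obtain ⟨T, hT, W, hW, hlt⟩ := eventually_prod_iff.1 (hg.eventually_lex_lt hφ hφm hk hab)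
    rw [← nhds_prod_eq] at hW
    obtain ⟨U, V, hU, haU, hV, hbV, hUV⟩ := mem_nhds_prod_iff'.1 hW
    refine ⟨U, hU.mem_nhds haU, V, hV.mem_nhds hbV, ?_⟩
    simp only [Measure.map_apply (measurable_sub_const _), hU.measurableSet, hV.measurableSet]
    exact ae_kernel_eq_zero_or_eq_zero hμ (continuous_of_convexOn_univ hconv)
      (continuous_of_convexOn_univ hk.convexOn) hnonneg k0 hπ hfin kfin hU.measurableSet
      hV.measurableSet (hT.mono fun t ht z hz w hw => hlt ht (hUV (mk_mem_prod hz hw)))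
  refine inducedByMap_compProd (hdirac.mono fun x ⟨y, hy⟩ => ⟨y + x, ?_⟩)
  have hy' := congrArg (Measure.map (· + x)) hy
  rw [Measure.map_map (measurable_add_const x) (measurable_sub_const x),
    Measure.map_dirac' (measurable_add_const x)] at hy'
  simpa [Function.comp_def] using hy'

end Dirac

section Uniqueness

theorem eq_map_graph_of_ae_snd_eq {X Y : Type*} [MeasurableSpace X] [MeasurableSpace Y]
    {π : Measure (X × Y)} {T : X → Y} (hT : Measurable T) (h : ∀ᵐ z ∂π, z.2 = T z.1) :
    π = (π.map Prod.fst).map fun x => (x, T x) := by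
  have hgraph : id =ᵐ[π] fun z => (z.1, T z.1) := h.mono fun z hz => Prod.ext rfl hz
  have hT' : Measurable fun x => (x, T x) := measurable_id.prodMk hT
  rw [Measure.map_map hT' measurable_fst, Function.comp_def, ← Measure.map_congr hgraph,
    Measure.map_id]

variable {N : ℕ} {μ ν : Measure (E N)} {π π' : Measure (E N × E N)} {c k : E N → E N → ℝ≥0∞}

theorem InducedByMap.exists_measurable (h : InducedByMap μ π) :
    ∃ T : E N → E N, Measurable T ∧ ∀ᵐ z ∂π, z.2 = T z.1 := by
  obtain ⟨T, hT, rfl⟩ := h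
  refine ⟨hT.mk T, hT.measurable_mk, ?_⟩
  exact (ae_map_iff (by fun_prop)
    (measurableSet_eq_fun measurable_snd (hT.measurable_mk.comp measurable_fst))).2 hT.ae_eq_mk

theorem eq_of_inducedByMap_average (hπ : π ∈ Adm μ ν) (hπ' : π' ∈ Adm μ ν)
    (h : InducedByMap μ ((2⁻¹ : ℝ≥0∞) • (π + π'))) : π = π' := by
  obtain ⟨T, hT, hgraph⟩ := h.exists_measurable
  rw [Measure.ae_ennreal_smul_measure_iff (by simp), ae_add_measure_iff] at hgraph
  rw [eq_map_graph_of_ae_snd_eq hT hgraph.1, eq_map_graph_of_ae_snd_eq hT hgraph.2, hπ.2.1,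
    hπ'.2.1]

theorem average_mem_adm (hπ : π ∈ Adm μ ν) (hπ' : π' ∈ Adm μ ν) :
    (2⁻¹ : ℝ≥0∞) • (π + π') ∈ Adm μ ν := by
  have := hπ.1
  have := hπ'.1
  have haverage : ∀ m : Measure (E N), (2⁻¹ : ℝ≥0∞) • (m + m) = m := fun m => by
    rw [← two_smul ℝ≥0∞ m, smul_smul, ENNReal.inv_mul_cancel two_ne_zero ENNReal.ofNat_ne_top,
      one_smul]
  refine ⟨⟨?_⟩, ?_, ?_⟩
  · rw [Measure.smul_apply, Measure.add_apply, measure_univ, measure_univ, one_add_one_eq_two,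
      smul_eq_mul, ENNReal.inv_mul_cancel two_ne_zero ENNReal.ofNat_ne_top]
  · rw [Measure.map_smul, Measure.map_add _ _ measurable_fst, hπ.2.1, hπ'.2.1, haverage]
  · rw [Measure.map_smul, Measure.map_add _ _ measurable_snd, hπ.2.2, hπ'.2.2, haverage]

theorem planCost_average (h : planCost c π = planCost c π') :
    planCost c ((2⁻¹ : ℝ≥0∞) • (π + π')) = planCost c π := by
  calc planCost c ((2⁻¹ : ℝ≥0∞) • (π + π')) = 2⁻¹ * (planCost c π + planCost c π') := by
        simp only [planCost, lintegral_smul_measure, lintegral_add_measure, smul_eq_mul]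
    _ = planCost c π := by
        rw [← h, ← two_mul, ← mul_assoc, ENNReal.inv_mul_cancel two_ne_zero ENNReal.ofNat_ne_top,
          one_mul]

theorem average_mem_secondaryPlans (hπ : π ∈ SecondaryPlans c k μ ν)
    (hπ' : π' ∈ SecondaryPlans c k μ ν) :
    (2⁻¹ : ℝ≥0∞) • (π + π') ∈ SecondaryPlans c k μ ν := by
  have hc := planCost_average (le_antisymm (hπ.1.2 π' hπ'.1.1) (hπ'.1.2 π hπ.1.1))
  have hk := planCost_average (le_antisymm (hπ.2 π' hπ'.1) (hπ'.2 π hπ.1))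
  exact ⟨⟨average_mem_adm hπ.1.1 hπ'.1.1, fun σ hσ => hc.trans_le (hπ.1.2 σ hσ)⟩,
    fun σ hσ => hk.trans_le (hπ.2 σ hσ)⟩

theorem subsingleton_secondaryPlans (h : ∀ π ∈ SecondaryPlans c k μ ν, InducedByMap μ π) :
    (SecondaryPlans c k μ ν).Subsingleton := fun _ hπ _ hπ' =>
  eq_of_inducedByMap_average hπ.1.1 hπ'.1.1 (h _ (average_mem_secondaryPlans hπ hπ'))

end Uniqueness

section Moments

theorem memLp_ofReal_iff {Ω F : Type*} [MeasurableSpace Ω] [NormedAddCommGroup F] {m : Measure Ω}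
    {f : Ω → F} (hf : AEStronglyMeasurable f m) {p : ℝ} (hp : 0 < p) :
    MemLp f (ENNReal.ofReal p) m ↔ ∫⁻ ω, ENNReal.ofReal (‖f ω‖ ^ p) ∂m < ∞ := by
  have hnorm : ∀ ω, ENNReal.ofReal (‖f ω‖ ^ p) = ‖f ω‖ₑ ^ p := fun ω => by
    rw [← ENNReal.ofReal_rpow_of_nonneg (norm_nonneg _) hp.le, ofReal_norm]
  simp_rw [hnorm]
  rw [MemLp, and_iff_right hf, eLpNorm_lt_top_iff_lintegral_rpow_enorm_lt_top
    (ENNReal.ofReal_pos.2 hp).ne' ENNReal.ofReal_ne_top, ENNReal.toReal_ofReal hp.le]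

variable {N : ℕ} {μ ν : Measure (E N)} {π : Measure (E N × E N)} {p q : ℝ}

theorem FiniteMoment.memLp_sub (hp : 0 < p) (hμ : FiniteMoment p μ) (hν : FiniteMoment p ν)
    (hπ : π ∈ Adm μ ν) : MemLp (fun z => z.2 - z.1) (ENNReal.ofReal p) π := by
  have hid : ∀ {m : Measure (E N)}, FiniteMoment p m → MemLp id (ENNReal.ofReal p) m :=
    (memLp_ofReal_iff aestronglyMeasurable_id hp).2
  have hfst : MemLp id (ENNReal.ofReal p) (π.map Prod.fst) := hπ.2.1 ▸ hid hμ
  have hsnd : MemLp id (ENNReal.ofReal p) (π.map Prod.snd) := hπ.2.2 ▸ hid hν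
  exact (hsnd.comp_of_map measurable_snd.aemeasurable).sub
    (hfst.comp_of_map measurable_fst.aemeasurable)

theorem FiniteMoment.planCost_seminorm_rpow_lt_top (n : Seminorm ℝ (E N)) (hq : 0 < q)
    (hqp : q ≤ p) (hμ : FiniteMoment p μ) (hν : FiniteMoment p ν) (hπ : π ∈ Adm μ ν) :
    planCost (dispCost fun x => n x ^ q) π < ∞ := by
  have := hπ.1
  obtain ⟨C, -, hC⟩ := n.bound_of_continuous_normedSpace (continuous_seminorm n)
  have hmeas : AEStronglyMeasurable (fun z : E N × E N => n (z.2 - z.1)) π :=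
    ((continuous_seminorm n).comp (by fun_prop)).aestronglyMeasurable
  have hsub : MemLp (fun z => z.2 - z.1) (ENNReal.ofReal q) π :=
    (hμ.memLp_sub (hq.trans_le hqp) hν hπ).mono_exponent (ENNReal.ofReal_le_ofReal hqp)
  have hn : MemLp (fun z => n (z.2 - z.1)) (ENNReal.ofReal q) π :=
    hsub.of_le_mul hmeas (.of_forall fun z =>
      (Real.norm_of_nonneg (apply_nonneg n _)).trans_le (hC _))
  simpa only [planCost, dispCost, Real.norm_of_nonneg (apply_nonneg n _)] using
    (memLp_ofReal_iff hmeas hq).1 hn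

end Moments

section OptimalMap

variable {N : ℕ} {μ ν : Measure (E N)}

theorem CylinderLike.exists_secondaryPlans_eq_singleton [IsProbabilityMeasure μ]
    [IsProbabilityMeasure ν] {g : E N → ℝ} (hg : CylinderLike g) {φ : ℝ → ℝ}
    (hφ : StrictConvexOn ℝ (Ici 0) φ) (hφm : MonotoneOn φ (Ici 0)) (hφ0 : 0 ≤ φ 0)
    {k : E N → ℝ} (hk : StrictConvexOn ℝ univ k) (k0 : ∀ x, 0 ≤ k x) (hμ : μ ≪ volume)
    (hfin : transportCost (dispCost fun x => φ (g x)) μ ν < ∞)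
    (kfin : ⨅ π ∈ Plans₁ (dispCost fun x => φ (g x)) μ ν, planCost (dispCost k) π < ∞) :
    ∃ π, SecondaryPlans (dispCost fun x => φ (g x)) (dispCost k) μ ν = {π} ∧
      InducedByMap μ π := by
  have hinduced : ∀ π ∈ SecondaryPlans (dispCost fun x => φ (g x)) (dispCost k) μ ν,
      InducedByMap μ π := fun π hπ =>
    hg.inducedByMap_of_mem_secondaryPlans hφ hφm hφ0 hk k0 hμ hπ
      ((le_iInf₂ hπ.1.2).trans_lt hfin).ne ((le_iInf₂ hπ.2).trans_lt kfin).ne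
  have hcont := continuous_of_convexOn_univ
    (convexOn_comp_of_monotoneOn_Ici hφ.convexOn hφm hg.2.1 hg.1)
  obtain ⟨π, hπ⟩ := secondaryPlans_nonempty (μ := μ) (ν := ν) (continuous_dispCost hcont)
    (continuous_dispCost (continuous_of_convexOn_univ hk.convexOn))
  exact ⟨π, (subsingleton_secondaryPlans hinduced).eq_singleton_of_mem hπ, hinduced π hπ⟩

theorem sqDist_eq_dispCost : (sqDist : E N → E N → ℝ≥0∞) = dispCost fun x => ‖x‖ ^ (2 : ℝ) := by
  ext x y
  rw [sqDist, dispCost, edist_dist, dist_comm, dist_eq_norm, Real.rpow_two,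
    ENNReal.ofReal_pow (norm_nonneg _)]

variable [IsProbabilityMeasure μ] [IsProbabilityMeasure ν] {n : Seminorm ℝ (E N)} {p q : ℝ}

theorem FiniteMoment.transportCost_normCost_lt_top (n : Seminorm ℝ (E N)) (hp : 0 < p)
    (hμp : FiniteMoment p μ) (hνp : FiniteMoment p ν) : transportCost (normCost n p) μ ν < ∞ :=
  (iInf₂_le _ prod_mem_adm).trans_lt
    (hμp.planCost_seminorm_rpow_lt_top n hp le_rfl hνp prod_mem_adm)

theorem FiniteMoment.iInf_plans₁_lt_top (hq : 0 < q) (hqp : q ≤ p)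
    (hμp : FiniteMoment p μ) (hνp : FiniteMoment p ν) :
    ⨅ π ∈ Plans₁ (normCost n p) μ ν, planCost (dispCost fun x => ‖x‖ ^ q) π < ∞ := by
  have hcont : Continuous fun z : E N × E N => normCost n p z.1 z.2 :=
    continuous_dispCost ((continuous_seminorm n).rpow_const fun _ => .inr (hq.trans_le hqp).le)
  obtain ⟨π, hπ⟩ := secondaryPlans_nonempty (μ := μ) (ν := ν) hcont hcont
  exact (iInf₂_le π hπ.1).trans_lt
    (hμp.planCost_seminorm_rpow_lt_top (normSeminorm ℝ (E N)) hq hqp hνp hπ.1.1)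

theorem CylinderLike.exists_secondaryPlans_norm_rpow_eq_singleton (hn : CylinderLike n)
    (hp : 1 < p) (hq : 1 < q) (hμp : FiniteMoment p μ) (hνp : FiniteMoment p ν) (hμ : μ ≪ volume)
    (hsec : ⨅ π ∈ Plans₁ (normCost n p) μ ν, planCost (dispCost fun x => ‖x‖ ^ q) π < ∞) :
    ∃ π, SecondaryPlans (normCost n p) (dispCost fun x => ‖x‖ ^ q) μ ν = {π} ∧
      InducedByMap μ π :=
  hn.exists_secondaryPlans_eq_singleton (strictConvexOn_rpow hp)
    (Real.monotoneOn_rpow_Ici_of_exponent_nonneg (by linarith)) (Real.rpow_nonneg le_rfl p)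
    (strictConvexOn_norm_rpow hq) (fun x => Real.rpow_nonneg (norm_nonneg x) q) hμ
    (hμp.transportCost_normCost_lt_top n (by linarith) hνp) hsec

theorem CylinderLike.exists_plans₂_eq_singleton (hn : CylinderLike n) (hp : 1 < p)
    (hμp : FiniteMoment p μ) (hνp : FiniteMoment p ν) (hμ : μ ≪ volume)
    (hsec : secondaryCost (normCost n p) μ ν < ∞) :
    ∃ π, Plans₂ (normCost n p) μ ν = {π} ∧ InducedByMap μ π := by
  rw [secondaryCost, sqDist_eq_dispCost] at hsec
  rw [Plans₂, sqDist_eq_dispCost]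
  exact hn.exists_secondaryPlans_norm_rpow_eq_singleton hp one_lt_two hμp hνp hμ hsec

theorem CylinderLike.exists_mem_plans₂_inducedByMap (hn : CylinderLike n) (hp : 1 < p)
    (hμp : FiniteMoment p μ) (hνp : FiniteMoment p ν) (hμ : μ ≪ volume) :
    ∃ π ∈ Plans₂ (normCost n p) μ ν, InducedByMap μ π := by
  rcases lt_or_ge (secondaryCost (normCost n p) μ ν) ∞ with hsec | hsec
  · obtain ⟨π, hπ, hinduced⟩ := hn.exists_plans₂_eq_singleton hp hμp hνp hμ hsec
    exact ⟨π, hπ ▸ mem_singleton π, hinduced⟩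
  · -- Every optimal plan now lies in `Plans₂`, so we may select one by another secondary cost.
    have hp0 : 0 < p := by linarith
    obtain ⟨π, hπ, hinduced⟩ := hn.exists_secondaryPlans_norm_rpow_eq_singleton hp hp hμp hνp hμ
      (hμp.iInf_plans₁_lt_top hp0 le_rfl hνp)
    have hπ₁ := (eq_singleton_iff_unique_mem.1 hπ).1.1
    exact ⟨π, ⟨hπ₁, fun π' hπ' => le_top.trans (hsec.trans (iInf₂_le π' hπ'))⟩, hinduced⟩

theorem FiniteMoment.secondaryCost_lt_top (hp : 2 ≤ p) (hμp : FiniteMoment p μ)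
    (hνp : FiniteMoment p ν) : secondaryCost (normCost n p) μ ν < ∞ := by
  rw [secondaryCost, sqDist_eq_dispCost]
  exact hμp.iInf_plans₁_lt_top two_pos hp hνp

end OptimalMap

end CylTransport

theorem mainTheorem2_general :
    (∀ (N : ℕ) (n : Seminorm ℝ (CylTransport.E N)), CylTransport.CylinderLike n →
      ∀ p : ℝ, 1 < p →
      ∀ μ ν : Measure (CylTransport.E N), IsProbabilityMeasure μ → IsProbabilityMeasure ν →
      CylTransport.FiniteMoment p μ → CylTransport.FiniteMoment p ν → μ ≪ volume →
        CylTransport.transportCost (CylTransport.normCost n p) μ ν < ∞ ∧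
        (∃ π ∈ CylTransport.Plans₂ (CylTransport.normCost n p) μ ν,
          CylTransport.InducedByMap μ π) ∧
        (2 ≤ p ∨ CylTransport.secondaryCost (CylTransport.normCost n p) μ ν < ∞ →
          ∃ π, CylTransport.Plans₂ (CylTransport.normCost n p) μ ν = {π} ∧
            CylTransport.InducedByMap μ π)) ∧
    (∀ n : Seminorm ℝ (CylTransport.E 2), CylTransport.CylinderLike n) ∧
    (∀ (N : ℕ) (V : Finset (CylTransport.E N)),
      CylTransport.CylinderLike (CylTransport.crystalline V) ∧
        (Submodule.span ℝ (V : Set (CylTransport.E N)) = ⊤ →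
          CylTransport.IsNorm (CylTransport.crystalline V))) := by
  refine ⟨fun N n hn p hp μ ν _ _ hμp hνp hμ => ⟨?_, ?_, fun h => ?_⟩,
    CylTransport.cylinderLike_seminorm_two,
    fun N V => ⟨CylTransport.cylinderLike_crystalline V, CylTransport.isNorm_crystalline⟩⟩
  · exact hμp.transportCost_normCost_lt_top n (by linarith) hνp
  · exact hn.exists_mem_plans₂_inducedByMap hp hμp hνp hμ
  · exact hn.exists_plans₂_eq_singleton hp hμp hνp hμ
      (h.elim (fun h2 => hμp.secondaryCost_lt_top h2 hνp) id)

theorem mainTheorem2 :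
    (∀ (N : ℕ) (n : Seminorm ℝ (CylTransport.E N)),
      CylTransport.IsNorm n → CylTransport.CylinderLike n →
      ∀ p : ℝ, 1 < p →
      ∀ μ ν : Measure (CylTransport.E N), IsProbabilityMeasure μ → IsProbabilityMeasure ν →
      CylTransport.FiniteMoment p μ → CylTransport.FiniteMoment p ν → μ ≪ volume →
        CylTransport.transportCost (CylTransport.normCost n p) μ ν < ∞ ∧
        (∃ π ∈ CylTransport.Plans₂ (CylTransport.normCost n p) μ ν,
          CylTransport.InducedByMap μ π) ∧
        (2 ≤ p ∨ CylTransport.secondaryCost (CylTransport.normCost n p) μ ν < ∞ →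
          ∃ π, CylTransport.Plans₂ (CylTransport.normCost n p) μ ν = {π} ∧
            CylTransport.InducedByMap μ π)) ∧
    (∀ n : Seminorm ℝ (CylTransport.E 2),
      CylTransport.IsNorm n → CylTransport.CylinderLike n) ∧
    (∀ (N : ℕ) (V : Finset (CylTransport.E N)),
      Submodule.span ℝ (V : Set (CylTransport.E N)) = ⊤ →
        CylTransport.IsNorm (CylTransport.crystalline V) ∧
        CylTransport.CylinderLike (CylTransport.crystalline V)) :=
  ⟨fun N n _ => mainTheorem2_general.1 N n, fun n _ => mainTheorem2_general.2.1 n,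
    fun N V hV => ⟨(mainTheorem2_general.2.2 N V).2 hV, (mainTheorem2_general.2.2 N V).1⟩⟩
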